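/- Let $\Sigma=\{1,\dots,N\}$ index sources and $\Pi=\{1,\dots,M\}$ index sinks. Let $X=(X_i)_{i\in\Sigma}$ have an arbitrary joint distribution $p$ on a product of finite alphabets $\prod_{i}\mathcal X_i$, and let $X^n$ be $n$ i.i.d. copies of $X$; source node $i$ observes $X_i^n$. Sink $j$ wants to reconstruct $(X_i^n)_{i\in\Sigma_j}$, where $\Sigma_j\subseteq\Sigma$; put $\Pi_i=\{j : i\in\Sigma_j\}$. Suppose that each sink receives packets only from the sources it reconstructs. That is, a code of length $n$ for dispersive information routing (DIR) consists of positive integers $L_{i,K}$ for $i\in\Sigma$ and $\emptyset\ne K\subseteq\Pi_i$; of encoders $f_i^E:\mathcal X_i^n\to\prod_{\emptyset\neq K\subseteq\Pi_i}\{1,\dots,L_{i,K}\}$, whose component $T_{i,K}$ is a packet delivered exactly to the sinks in $K$; and of decoders $f_j^D$ that map the received packets $(T_{i,K})_{i\in\Sigma_j,\,j\in K\subseteq\Pi_i}$ to an estimate of $(X_i^n)_{i\in\Sigma_j}$. Its error probability is $P_e=\frac1M\sum_{j}P(\text{the estimate at sink } j\text{ is wrong})$. A rate tuple $R=(R_{i,K})_{i\in\Sigma,\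 \emptyset\ne K\subseteq\Pi_i}$ is achievable if for all $\eta>0$ and $0<\epsilon<1$ there is, for every sufficiently large $n$, a code of length $n$ with $\frac1n\log_2 L_{i,K}\le R_{i,K}+\eta$ for all $i,K$ and $P_e<\epsilon$. Then: (a) The set of achievable rate tuples is exactly the set of tuples $R$ with all $R_{i,K}\ge0$ such that, for every sink $j$ and every nonempty $S\subseteq\Sigma_j$, $$\sum_{i\in S}\ \sum_{K\subseteq\Pi_i,\ K\ni j}R_{i,K}\ \ge\ H\bigl(X_S\mid X_{\Sigma_j\setminus S}\bigr),$$ where $H$ is entropy in bits and $X_S=(X_i)_{i\in S}$. (b) Every tuple of this region is achieved by power binning. In power binning with typicality parameter $\delta$ and bin numbers $L_{i,K}$, every sequence in $\mathcal X_i^n$ is assigned, for each nonempty $K\subseteq\Pi_i$, an index uniform on $\{1,\dots,L_{i,K}\}$, all indices being independent; encoder $i$ puts the indices of its observed sequence into the packets $T_{i,K}$ if the sequence is typical, and sends a fixed index otherwise; and sink $j$ outputs the unique jointly typical tuple in $\prod_{i\in\Sigma_j}\mathcal X_i^n$ whose indices agree with those received, or an arbitrary tuple if there is no unique such tuple. Here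 a sequence is typical for a distribution $q$ if the empirical frequency of each letter $b$ differs from $q(b)$ by at most $\delta q(b)$. For every $R$ in the region, all $\eta>0$ and $0<\epsilon<1$, and every sufficiently small $\delta>0$, there are, for every sufficiently large $n$, bin numbers with $\frac1n\log_2L_{i,K}\le R_{i,K}+\eta$ for all $i,K$ such that $P_e$, averaged over the random index assignment, is less than $\epsilon$. -/

import Mathlib

noncomputable section

namespace DIR

/-! ### Finite probability: laws, conditional entropy, typicality -/

/-- The law (probability mass function) of the random variable `f` when the sample point is
distributed according to the probability mass function `p`. -/
def law {α β : Type*} [Fintype α] (p : α → ℝ) (f : α → β) (b : β) : ℝ :=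
  open Classical in ∑ a with f a = b, p a

/-- The conditional entropy `H(f | g)` in bits: the expectation of
`- log₂ P(f, g) / P(g)`. Points `a` with `p a = 0` contribute `0`. -/
def condEntropy {α β γ : Type*} [Fintype α] (p : α → ℝ) (f : α → β) (g : α → γ) : ℝ :=
  - ∑ a, p a * Real.logb 2 (law p (fun a => (f a, g a)) (f a, g a) / law p g (g a))

/-- Strong (letter) typicality: the empirical frequency of every letter `b` is within relative
error `δ` of `q b`. In particular letters of probability `0` do not occur. -/
def IsTypical {β : Type*} {n : ℕ} (δ : ℝ) (q : β → ℝ) (y : Fin n → β) : Prop :=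
  ∀ b, |(Nat.card {t : Fin n // y t = b} : ℝ) / n - q b| ≤ δ * q b

/-- Probability of the block `x` of `n` independent draws from `p`. -/
def blockProb {α : Type*} {n : ℕ} (p : α → ℝ) (x : Fin n → α) : ℝ := ∏ t, p (x t)

/-! ### Codes -/

variable {N M : ℕ} {𝒳 : Fin N → Type*}

/-- A block code of length `n` for dispersive information routing. Sink `j` requests the sources
in `Sig j`. Source `i` emits one packet for every set of sinks `K ∈ pk i`; this packet carries an
index out of `L i K` possible ones and is delivered to exactly the sinks in `K`. Each encoder sees
only its own source; the decoder of sink `j` sees exactly the packets whose destination set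
contains `j`. (With `pk i` the family of all nonempty sets of sinks, every source may communicate
with every sink.) -/
structure Code (𝒳 : Fin N → Type*) (Sig : Fin M → Finset (Fin N))
    (pk : Fin N → Finset (Finset (Fin M))) (n : ℕ) where
  /-- number of values of each packet -/
  L : ∀ i, pk i → ℕ+
  /-- encoders -/
  enc : ∀ i, (Fin n → 𝒳 i) → ∀ K : pk i, Fin (L i K)
  /-- decoders -/
  dec : ∀ j, (∀ i, ∀ K : {K : pk i // j ∈ K.1}, Fin (L i K.1)) →
    ∀ i : Sig j, Fin n → 𝒳 i

/-- What sink `j` outputs when the sources emit the block `x`. -/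
def Code.estimate {Sig : Fin M → Finset (Fin N)} {pk : Fin N → Finset (Finset (Fin M))} {n : ℕ}
    (c : Code 𝒳 Sig pk n) (j : Fin M) (x : Fin n → ∀ i, 𝒳 i) : ∀ i : Sig j, Fin n → 𝒳 i :=
  c.dec j fun i K => c.enc i (fun t => x t i) K.1

/-- The probability of error of a code, averaged over the sinks, when the sources emit `n`
independent draws from the joint probability mass function `p`. -/
def Code.errorProb {Sig : Fin M → Finset (Fin N)} {pk : Fin N → Finset (Finset (Fin M))} {n : ℕ}
    [∀ i, Fintype (𝒳 i)] (p : (∀ i, 𝒳 i) → ℝ) (c : Code 𝒳 Sig pk n) : ℝ :=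
  open Classical in
  (1 / (M : ℝ)) * ∑ j : Fin M,
    ∑ x : Fin n → ∀ i, 𝒳 i with c.estimate j x ≠ fun (i : Sig j) t => x t i, blockProb p x

/-- Achievability of a rate tuple (in bits per source symbol) with codes whose packets are those
in `pk`. -/
def Achievable [∀ i, Fintype (𝒳 i)] (p : (∀ i, 𝒳 i) → ℝ) (Sig : Fin M → Finset (Fin N))
    (pk : Fin N → Finset (Finset (Fin M))) (R : ∀ i, pk i → ℝ) : Prop :=
  ∀ η : ℝ, 0 < η → ∀ ε : ℝ, 0 < ε → ε < 1 → ∃ n₀ : ℕ, ∀ n : ℕ, n₀ ≤ n →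
    ∃ c : Code 𝒳 Sig pk n,
      (∀ i K, 1 / (n : ℝ) * Real.logb 2 (c.L i K : ℝ) ≤ R i K + η) ∧ c.errorProb p < ε

/-! ### No helpers -/

/-- The set `Π_i` of sinks that request source `i`. -/
def requesters (Sig : Fin M → Finset (Fin N)) (i : Fin N) : Finset (Fin M) :=
  {j | i ∈ Sig j}

/-- The packets permitted when sinks receive packets only from sources they request: source `i`
emits a packet for each nonempty set of sinks `K ⊆ Π_i`. -/
def noHelperPackets (Sig : Fin M → Finset (Fin N)) (i : Fin N) : Finset (Finset (Fin M)) :=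
  {K | K.Nonempty ∧ K ⊆ requesters Sig i}

/-- The nonnegative rate tuples satisfying, for every sink `j` and every nonempty `S ⊆ Sig j`,
`∑_{i ∈ S} ∑_{K ⊆ Π_i, j ∈ K} R i K ≥ H(X_S | X_{Sig j - S})`. -/
def noHelperRegion [∀ i, Fintype (𝒳 i)] (p : (∀ i, 𝒳 i) → ℝ) (Sig : Fin M → Finset (Fin N)) :
    Set (∀ i, noHelperPackets Sig i → ℝ) :=
  {R | (∀ i K, 0 ≤ R i K) ∧
    ∀ j, ∀ S : Finset (Fin N), S ⊆ Sig j → S.Nonempty →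
      condEntropy p (S.restrict (π := 𝒳)) ((Sig j \ S).restrict (π := 𝒳)) ≤
        ∑ i ∈ S, ∑ K : noHelperPackets Sig i with j ∈ K.1, R i K}

/-! ### Power binning -/

/-- A binning: each sequence of source `i` is given one bin index for each nonempty `K ⊆ Π_i`. -/
abbrev Binning (𝒳 : Fin N → Type*) (Sig : Fin M → Finset (Fin N)) (n : ℕ)
    (L : ∀ i, noHelperPackets Sig i → ℕ+) : Type _ :=
  ∀ i, (Fin n → 𝒳 i) → ∀ K : noHelperPackets Sig i, Fin (L i K)

/-- The tuple of sequences `z` (for the sources requested by sink `j`) is jointly typical, and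
its bin indices are the received indices `T`. -/
def BinMatch [∀ i, Fintype (𝒳 i)] (p : (∀ i, 𝒳 i) → ℝ) {Sig : Fin M → Finset (Fin N)} {n : ℕ}
    (δ : ℝ) {L : ∀ i, noHelperPackets Sig i → ℕ+} (b : Binning 𝒳 Sig n L) (j : Fin M)
    (T : ∀ i, ∀ K : {K : noHelperPackets Sig i // j ∈ K.1}, Fin (L i K.1))
    (z : ∀ i : Sig j, Fin n → 𝒳 i) : Prop :=
  IsTypical δ (law p ((Sig j).restrict (π := 𝒳))) (fun t i => z i t) ∧
    ∀ (i : Sig j) (K : {K : noHelperPackets Sig i // j ∈ K.1}), b i (z i) K.1 = T i K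

/-- The code given by a binning. Encoder `i` sends the bin indices of its sequence if the
sequence is typical, and a fixed index otherwise (an encoding error). Decoder `j` outputs the
unique jointly typical tuple in the received bins; if there is none, or more than one, its output
is arbitrary (a decoding error). -/
def powerBinningCode [∀ i, Fintype (𝒳 i)] [∀ i, Nonempty (𝒳 i)] (p : (∀ i, 𝒳 i) → ℝ)
    {Sig : Fin M → Finset (Fin N)} {n : ℕ} (δ : ℝ) {L : ∀ i, noHelperPackets Sig i → ℕ+}
    (b : Binning 𝒳 Sig n L) : Code 𝒳 Sig (noHelperPackets Sig) n :=
  open Classical in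
  { L := L
    enc := fun i y K =>
      if IsTypical δ (law p fun x : ∀ i, 𝒳 i => x i) y then b i y K else ⟨0, (L i K).pos⟩
    dec := fun j T =>
      if h : ∃! z, BinMatch p δ b j T z then h.choose else Classical.arbitrary _ }

/-- The error probability of power binning with bin numbers `L`, averaged over a uniformly random
binning, that is, with all bin indices drawn independently and uniformly. -/
def powerBinningError [∀ i, Fintype (𝒳 i)] [∀ i, Nonempty (𝒳 i)] (p : (∀ i, 𝒳 i) → ℝ)
    (Sig : Fin M → Finset (Fin N)) (n : ℕ) (δ : ℝ) (L : ∀ i, noHelperPackets Sig i → ℕ+) : ℝ :=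
  open Classical in
  (1 / (Fintype.card (Binning 𝒳 Sig n L) : ℝ)) *
    ∑ b : Binning 𝒳 Sig n L, (powerBinningCode p δ b).errorProb p

/-- Achievability of a rate tuple by power binning: for every sufficiently small typicality
parameter and all large block lengths, random power binning with rates exceeding those of the
tuple by at most `η` has average error probability less than `ε`. -/
def AchievableByPowerBinning [∀ i, Fintype (𝒳 i)] [∀ i, Nonempty (𝒳 i)] (p : (∀ i, 𝒳 i) → ℝ)
    (Sig : Fin M → Finset (Fin N)) (R : ∀ i, noHelperPackets Sig i → ℝ) : Prop :=
  ∀ η : ℝ, 0 < η → ∀ ε : ℝ, 0 < ε → ε < 1 → ∃ δ₀ : ℝ, 0 < δ₀ ∧ ∀ δ : ℝ, 0 < δ → δ < δ₀ →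
    ∃ n₀ : ℕ, ∀ n : ℕ, n₀ ≤ n → ∃ L : ∀ i, noHelperPackets Sig i → ℕ+,
      (∀ i K, 1 / (n : ℝ) * Real.logb 2 (L i K : ℝ) ≤ R i K + η) ∧
        powerBinningError p Sig n δ L < ε

end DIR

end

/-!
*Converse.* A sink that reconstructs `X_S` knows it from `X_{Sig j \ S}` and the packets of the
sources in `S`. Hence, if these packets take `k` values, the probability of correct decoding is at
most `k * B` plus the probability that `P(x_S | x_{Sig j \ S}) > B`. By the weak law of large
numbers the latter vanishes for `B = 2 ^ (-n (H(X_S | X_{Sig j \ S}) - r))`, so `k` cannot be much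
smaller than `1 / B`.

*Achievability.* If the source block `x` is typical, sink `j` errs only if some other jointly
typical tuple has all the received indices. The tuples that differ from `x` in exactly the sources
of `S` number at most `2 ^ (n (1 + δ) H(X_S | X_{Sig j \ S}))`, and each agrees with `x` with
probability the inverse of the product of the bin numbers of the packets from `S` to `j`. The rate
constraints say that this beats the count, and the union bound over `S` concludes.
-/

namespace DIR

open Filter MeasureTheory ProbabilityTheory Topology

section Mass

variable {α β ι : Type*} [Fintype α] {w : α → ℝ}

/-- The total weight `∑ a ∈ E, w a`. For a probability mass function `w` this is the probability of
the event `E`; working with real weights on sets avoids all decidability and measurability side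
conditions. -/
noncomputable def mass (w : α → ℝ) (E : Set α) : ℝ := ∑ a, E.indicator w a

theorem mass_setOf (w : α → ℝ) (P : α → Prop) [DecidablePred P] :
    mass w {a | P a} = ∑ a with P a, w a := by
  simp [mass, Finset.sum_filter, Set.indicator_apply]

theorem mass_nonneg (hw : ∀ a, 0 ≤ w a) (E : Set α) : 0 ≤ mass w E :=
  Finset.sum_nonneg fun _ _ => Set.indicator_nonneg (fun _ _ => hw _) _

theorem mass_mono (hw : ∀ a, 0 ≤ w a) {E F : Set α} (h : E ⊆ F) : mass w E ≤ mass w F :=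
  Finset.sum_le_sum fun _ _ => Set.indicator_le_indicator_of_subset h hw _

theorem mass_empty (w : α → ℝ) : mass w ∅ = 0 := by simp [mass]

theorem mass_compl (w : α → ℝ) (E : Set α) : mass w Eᶜ = ∑ a, w a - mass w E := by
  simp [mass, Set.indicator_compl]

theorem mass_le_one (hw : w ∈ stdSimplex ℝ α) (E : Set α) : mass w E ≤ 1 := by
  have := mass_nonneg hw.1 Eᶜ
  rw [mass_compl, hw.2] at this
  linarith

theorem mass_union_le (hw : ∀ a, 0 ≤ w a) (E F : Set α) : mass w (E ∪ F) ≤ mass w E + mass w F := by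
  rw [mass, mass, mass, ← Finset.sum_add_distrib]
  refine Finset.sum_le_sum fun a _ => ?_
  rw [← Set.indicator_union_add_inter_apply]
  exact le_add_of_nonneg_right (Set.indicator_nonneg (fun _ _ => hw _) _)

theorem mass_biUnion_le (hw : ∀ a, 0 ≤ w a) (s : Finset ι) (E : ι → Set α) :
    mass w (⋃ i ∈ s, E i) ≤ ∑ i ∈ s, mass w (E i) := by
  classical
  induction s using Finset.induction_on with
  | empty => simp [mass_empty]
  | insert i s hi ih =>
    rw [Finset.set_biUnion_insert, Finset.sum_insert hi]
    exact (mass_union_le hw _ _).trans (by gcongr)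

theorem ncard_mul_le_mass {E : Set α} {c : ℝ} (hc : ∀ a ∈ E, c ≤ w a) :
    E.ncard * c ≤ mass w E := by
  classical
  calc E.ncard * c = mass (fun _ => c) E := by
        simp [mass, Set.indicator_apply, Finset.sum_ite, Set.ncard_eq_toFinset_card', Set.toFinset]
    _ ≤ mass w E := Finset.sum_le_sum fun a _ => by
        by_cases ha : a ∈ E <;> simp [ha, hc]

theorem mass_eq_sum_fiber [Fintype β] (w : α → ℝ) (E : Set α) (F : α → β) :
    mass w E = ∑ c, mass w (E ∩ F ⁻¹' {c}) := by
  classical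
  simp only [mass]
  rw [Finset.sum_comm]
  refine Finset.sum_congr rfl fun a _ => ?_
  simp [Set.indicator_apply, ite_and]

theorem sum_mul_le_mass_add (hw : w ∈ stdSimplex ℝ α) {φ : α → ℝ} (hφ : ∀ a, φ a ≤ 1) {E : Set α}
    {u : ℝ} (hu : 0 ≤ u) (hE : ∀ a ∉ E, φ a ≤ u) : ∑ a, w a * φ a ≤ mass w E + u := by
  calc ∑ a, w a * φ a ≤ ∑ a, (E.indicator w a + w a * u) := by
        refine Finset.sum_le_sum fun a _ => ?_
        by_cases ha : a ∈ E
        · rw [Set.indicator_of_mem ha]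
          exact (mul_le_of_le_one_right (hw.1 a) (hφ a)).trans
            (le_add_of_nonneg_right (mul_nonneg (hw.1 a) hu))
        · rw [Set.indicator_of_notMem ha, zero_add]
          exact mul_le_mul_of_nonneg_left (hE a ha) (hw.1 a)
    _ = mass w E + u := by rw [Finset.sum_add_distrib, ← Finset.sum_mul, hw.2, one_mul, mass]

end Mass

section Law

variable {α β γ : Type*} [Fintype α] {p : α → ℝ}

theorem law_eq_mass (p : α → ℝ) (f : α → β) (b : β) : law p f b = mass p (f ⁻¹' {b}) := by
  classical
  rw [law, ← mass_setOf]
  rfl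

theorem law_nonneg (hp : ∀ a, 0 ≤ p a) (f : α → β) (b : β) : 0 ≤ law p f b :=
  law_eq_mass p f b ▸ mass_nonneg hp _

theorem sum_law_mul [Fintype β] (p : α → ℝ) (f : α → β) (φ : β → ℝ) :
    ∑ b, law p f b * φ b = ∑ a, p a * φ (f a) := by
  classical
  rw [← Finset.sum_fiberwise Finset.univ f]
  refine Finset.sum_congr rfl fun b _ => ?_
  rw [law, Finset.sum_mul]
  refine Finset.sum_congr (by congr) fun a ha => ?_
  rw [(Finset.mem_filter.1 ha).2]

theorem sum_law [Fintype β] (p : α → ℝ) (f : α → β) : ∑ b, law p f b = ∑ a, p a := by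
  simpa using sum_law_mul p f 1

theorem le_law (hp : ∀ a, 0 ≤ p a) (f : α → β) (a : α) : p a ≤ law p f (f a) := by
  classical
  exact Finset.single_le_sum (f := p) (fun _ _ => hp _) (by simp)

theorem law_law [Fintype β] (p : α → ℝ) (f : α → β) (g : β → γ) (c : γ) :
    law (law p f) g c = law p (fun a => g (f a)) c := by
  classical
  simpa [law, Finset.sum_filter] using sum_law_mul p f (fun b => if g b = c then 1 else 0)

theorem law_congr (p : α → ℝ) {f : α → β} {g : α → γ} {b : β} {c : γ}
    (h : ∀ a, f a = b ↔ g a = c) : law p f b = law p g c := by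
  simp only [law_eq_mass, Set.preimage, Set.mem_singleton_iff, h]

theorem law_prodMk_le (hp : ∀ a, 0 ≤ p a) (f : α → β) (g : α → γ) (b : β) (c : γ) :
    law p (fun a => (f a, g a)) (b, c) ≤ law p g c := by
  rw [law_eq_mass, law_eq_mass]
  exact mass_mono hp fun a ha => congrArg Prod.snd ha

/-- The conditional probability `P(f = f a | g = g a)` appearing in `condEntropy`, as a function of
the sample point `a`. It is `0` when `g a` has probability `0`. -/
noncomputable def condProb (p : α → ℝ) (f : α → β) (g : α → γ) (a : α) : ℝ :=
  law p (fun a => (f a, g a)) (f a, g a) / law p g (g a)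

theorem condProb_nonneg (hp : ∀ a, 0 ≤ p a) (f : α → β) (g : α → γ) (a : α) :
    0 ≤ condProb p f g a :=
  div_nonneg (law_nonneg hp _ _) (law_nonneg hp _ _)

theorem condProb_le_one (hp : ∀ a, 0 ≤ p a) (f : α → β) (g : α → γ) (a : α) :
    condProb p f g a ≤ 1 :=
  div_le_one_of_le₀ (law_prodMk_le hp f g _ _) (law_nonneg hp _ _)

theorem condProb_mul_law (hp : ∀ a, 0 ≤ p a) (f : α → β) (g : α → γ) (a : α) :
    condProb p f g a * law p g (g a) = law p (fun a => (f a, g a)) (f a, g a) :=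
  div_mul_cancel_of_imp fun h =>
    le_antisymm (h ▸ law_prodMk_le hp f g _ _) (law_nonneg hp _ _)

theorem condEntropy_eq (p : α → ℝ) (f : α → β) (g : α → γ) :
    condEntropy p f g = -∑ a, p a * Real.logb 2 (condProb p f g a) := rfl

theorem condEntropy_law_id [Fintype β] (p : α → ℝ) (f : α → β) (g : β → γ) :
    condEntropy (law p f) id g = condEntropy p f (fun a => g (f a)) := by
  simp only [condEntropy, law_law, id,
    sum_law_mul p f fun b => Real.logb 2 (law p (fun a => (f a, g (f a))) (b, g b) /
      law p (fun a => g (f a)) (g b))]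

theorem condEntropy_congr_left {β' : Type*} (p : α → ℝ) {f : α → β} {f' : α → β'} {g : α → γ}
    (h : ∀ a a', g a = g a' → (f a = f a' ↔ f' a = f' a')) :
    condEntropy p f g = condEntropy p f' g := by
  have hlaw (a : α) : law p (fun a => (f a, g a)) (f a, g a)
      = law p (fun a => (f' a, g a)) (f' a, g a) :=
    law_congr p fun a' => by simpa using and_congr_left (h a' a)
  simp only [condEntropy, hlaw]

end Law

section Block

variable {α β γ : Type*} [Fintype α] {p : α → ℝ}

theorem law_blockProb (p : α → ℝ) (f : α → β) {n : ℕ} (u : Fin n → β) :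
    law (blockProb p) (fun (x : Fin n → α) t => f (x t)) u = blockProb (law p f) u := by
  classical
  simp only [law, blockProb, Finset.prod_univ_sum]
  refine Finset.sum_congr ?_ fun _ _ => rfl
  ext x
  simp [funext_iff]

theorem condProb_blockProb (p : α → ℝ) (f : α → β) (g : α → γ) {n : ℕ} (x : Fin n → α) :
    condProb (blockProb p) (fun x t => f (x t)) (fun x t => g (x t)) x
      = ∏ t, condProb p f g (x t) := by
  have hpair : law (blockProb p)
        (fun x : Fin n → α => ((fun t => f (x t)), fun t => g (x t)))
        ((fun t => f (x t)), fun t => g (x t))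
      = law (blockProb p) (fun (x : Fin n → α) t => (f (x t), g (x t)))
        fun t => (f (x t), g (x t)) :=
    law_congr _ fun x' => by simp [funext_iff, forall_and]
  rw [condProb, hpair, law_blockProb p (fun a => (f a, g a)), law_blockProb p g]
  simp only [condProb, blockProb, Finset.prod_div_distrib]

theorem blockProb_mem_stdSimplex (hp : p ∈ stdSimplex ℝ α) (n : ℕ) :
    (blockProb p : (Fin n → α) → ℝ) ∈ stdSimplex ℝ (Fin n → α) :=
  ⟨fun _ => Finset.prod_nonneg fun _ _ => hp.1 _, by
    simp only [blockProb, ← Fintype.sum_pow, hp.2, one_pow]⟩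

theorem exists_measureReal_singleton_eq [MeasurableSpace α] [MeasurableSingletonClass α]
    (hp : p ∈ stdSimplex ℝ α) :
    ∃ μ : Measure α, IsProbabilityMeasure μ ∧ ∀ a, μ.real {a} = p a := by
  have hsum : ∑ a, ENNReal.ofReal (p a) = 1 := by
    rw [← ENNReal.ofReal_sum_of_nonneg fun a _ => hp.1 a, hp.2, ENNReal.ofReal_one]
  refine ⟨(PMF.ofFintype _ hsum).toMeasure, inferInstance, fun a => ?_⟩
  rw [measureReal_def, PMF.toMeasure_apply_singleton _ _ (measurableSet_singleton a),
    PMF.ofFintype_apply, ENNReal.toReal_ofReal (hp.1 a)]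

theorem mass_blockProb_eq_measureReal_pi [MeasurableSpace α] [MeasurableSingletonClass α]
    {μ : Measure α} [IsProbabilityMeasure μ] (hμ : ∀ a, μ.real {a} = p a) {n : ℕ}
    (E : Set (Fin n → α)) :
    mass (blockProb p) E = (Measure.pi fun _ : Fin n => μ).real E := by
  classical
  have hsingleton (x : Fin n → α) : (Measure.pi fun _ : Fin n => μ).real {x} = blockProb p x := by
    simp only [measureReal_def, Measure.pi_singleton, ENNReal.toReal_prod, blockProb, ← hμ]
  have hE : ({x | x ∈ E} : Finset (Fin n → α)) = E := by simp
  conv_rhs => rw [← hE, ← sum_measureReal_singleton]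
  simp only [hsingleton, ← mass_setOf, Set.ofPred_mem_eq]

theorem measureReal_pi_deviation_le {Ω : Type*} [MeasurableSpace Ω] {μ : Measure Ω}
    [IsProbabilityMeasure μ] {φ : Ω → ℝ} (hφ : MemLp φ 2 μ) {r : ℝ} (hr : 0 < r) {n : ℕ}
    (hn : 0 < n) :
    (Measure.pi fun _ : Fin n => μ).real {x | r * n ≤ |∑ t, φ (x t) - n * ∫ a, φ a ∂μ|}
      ≤ Var[φ; μ] / r ^ 2 / n := by
  have hcoord (t : Fin n) : MemLp (fun x : Fin n → Ω => φ (x t)) 2 (Measure.pi fun _ => μ) :=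
    hφ.comp_measurePreserving (measurePreserving_eval _ t)
  have hmean : ∫ x, ∑ t, φ (x t) ∂(Measure.pi fun _ : Fin n => μ) = n * ∫ a, φ a ∂μ := by
    rw [integral_finsetSum _ fun t _ => (hcoord t).integrable (by norm_num)]
    simp [integral_comp_eval (μ := fun _ : Fin n => μ) hφ.aestronglyMeasurable]
  have hvar : Var[fun x => ∑ t, φ (x t); Measure.pi fun _ : Fin n => μ] = n * Var[φ; μ] := by
    have := variance_sum_pi (μ := fun _ : Fin n => μ) (X := fun _ => φ) fun _ => hφ
    simpa [Finset.sum_fn] using this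
  have hcheb := meas_ge_le_variance_div_sq (X := fun x : Fin n → Ω => ∑ t, φ (x t))
    (memLp_finsetSum Finset.univ fun t _ => hcoord t) (c := r * n) (by positivity)
  rw [hmean, hvar] at hcheb
  have hnonneg : 0 ≤ n * Var[φ; μ] / (r * n) ^ 2 :=
    div_nonneg (mul_nonneg n.cast_nonneg (variance_nonneg φ μ)) (sq_nonneg _)
  refine (ENNReal.toReal_le_of_le_ofReal hnonneg hcheb).trans_eq ?_
  field_simp

theorem tendsto_mass_deviation (hp : p ∈ stdSimplex ℝ α) (φ : α → ℝ) {r : ℝ} (hr : 0 < r) :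
    Tendsto (fun n : ℕ => mass (blockProb p)
      {x : Fin n → α | r * n ≤ |∑ t, φ (x t) - n * ∑ a, p a * φ a|}) atTop (𝓝 0) := by
  let : MeasurableSpace α := ⊤
  obtain ⟨μ, _, hμ⟩ := exists_measureReal_singleton_eq hp
  have hφ : MemLp φ 2 μ := .of_discrete
  have hmean : ∫ a, φ a ∂μ = ∑ a, p a * φ a := by
    simp only [integral_fintype .of_finite, hμ, smul_eq_mul]
  refine squeeze_zero' (.of_forall fun n => mass_nonneg (blockProb_mem_stdSimplex hp n).1 _) ?_
    (tendsto_const_div_atTop_nhds_zero_nat (Var[φ; μ] / r ^ 2))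
  filter_upwards [eventually_gt_atTop 0] with n hn
  rw [mass_blockProb_eq_measureReal_pi hμ, ← hmean]
  exact measureReal_pi_deviation_le hφ hr hn

end Block

section Typical

variable {α β γ : Type*} {q : β → ℝ} {n : ℕ} {δ : ℝ} {y : Fin n → β}

theorem natCard_eq_sum [DecidableEq β] (y : Fin n → β) (b : β) :
    (Nat.card {t : Fin n // y t = b} : ℝ) = ∑ t, if y t = b then 1 else 0 := by
  rw [Nat.card_eq_fintype_card, Fintype.card_subtype]
  simp

theorem IsTypical.pos (hq : ∀ b, 0 ≤ q b) (hy : IsTypical δ q y) (t : Fin n) : 0 < q (y t) := by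
  refine (hq _).lt_of_ne fun h => ?_
  have hzero := hy (y t)
  rw [← h, mul_zero, sub_zero, abs_nonpos_iff, div_eq_zero_iff] at hzero
  have hoccurs : 0 < Nat.card {s : Fin n // y s = y t} :=
    Nat.card_pos_iff.2 ⟨⟨⟨t, rfl⟩⟩, inferInstance⟩
  have hn : 0 < n := t.pos
  exact hzero.elim (mod_cast hoccurs.ne') (mod_cast hn.ne')

theorem IsTypical.natCard_le (hy : IsTypical δ q y) (b : β) :
    (Nat.card {t : Fin n // y t = b} : ℝ) ≤ n * ((1 + δ) * q b) := by
  rcases n.eq_zero_or_pos with rfl | hn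
  · simp
  · have := (abs_le.1 (hy b)).2
    rw [sub_le_iff_le_add, div_le_iff₀ (by positivity)] at this
    linarith

theorem IsTypical.sum_le [Fintype β] (hy : IsTypical δ q y) {φ : β → ℝ} (hφ : ∀ b, 0 ≤ φ b) :
    ∑ t, φ (y t) ≤ n * ((1 + δ) * ∑ b, q b * φ b) := by
  classical
  calc ∑ t, φ (y t) = ∑ b, (Nat.card {t : Fin n // y t = b} : ℝ) * φ b := by
        simp only [natCard_eq_sum, Finset.sum_mul, ite_mul, one_mul, zero_mul]
        rw [Finset.sum_comm]
        simp
    _ ≤ ∑ b, n * ((1 + δ) * q b) * φ b :=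
        Finset.sum_le_sum fun b _ => mul_le_mul_of_nonneg_right (hy.natCard_le b) (hφ b)
    _ = n * ((1 + δ) * ∑ b, q b * φ b) := by
        simp only [Finset.mul_sum, mul_assoc]

theorem IsTypical.map [Fintype β] (hy : IsTypical δ q y) (g : β → γ) :
    IsTypical δ (law q g) (fun t => g (y t)) := by
  classical
  intro c
  have hcount : (Nat.card {t : Fin n // g (y t) = c} : ℝ)
      = law (fun b => (Nat.card {t : Fin n // y t = b} : ℝ)) g c := by
    simp only [law, natCard_eq_sum]
    rw [Finset.sum_comm]
    simp
  rw [hcount, law, law, Finset.sum_div, ← Finset.sum_sub_distrib, Finset.mul_sum]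
  exact (Finset.abs_sum_le_sum_abs _ _).trans (Finset.sum_le_sum fun b _ => hy b)

theorem tendsto_mass_letter_deviation [Fintype α] {p : α → ℝ} (hp : p ∈ stdSimplex ℝ α)
    (hδ : 0 < δ) (a : α) :
    Tendsto (fun n : ℕ => mass (blockProb p)
      {x : Fin n → α | δ * p a < |(Nat.card {t // x t = a} : ℝ) / n - p a|}) atTop (𝓝 0) := by
  classical
  rcases (hp.1 a).eq_or_lt with hzero | hpos
  · refine tendsto_const_nhds.congr fun n => (Finset.sum_eq_zero fun x _ => ?_).symm
    refine Set.indicator_apply_eq_zero.2 fun hx => ?_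
    have hoccurs : ∃ t, x t = a := by
      by_contra! h
      simp [← hzero, h] at hx
    obtain ⟨t, ht⟩ := hoccurs
    exact Finset.prod_eq_zero (Finset.mem_univ t) (ht ▸ hzero.symm)
  · refine squeeze_zero' (.of_forall fun n => mass_nonneg (blockProb_mem_stdSimplex hp n).1 _) ?_
      (tendsto_mass_deviation hp (fun a' => if a' = a then 1 else 0) (mul_pos hδ hpos))
    filter_upwards [eventually_gt_atTop 0] with n hn
    refine mass_mono (blockProb_mem_stdSimplex hp n).1 fun x hx => ?_
    have hn' : (0 : ℝ) < n := mod_cast hn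
    have hmean : ∑ a', p a' * (if a' = a then 1 else 0) = p a := by simp
    calc δ * p a * n ≤ |(Nat.card {t // x t = a} : ℝ) / n - p a| * n :=
          mul_le_mul_of_nonneg_right hx.le hn'.le
      _ = |((Nat.card {t // x t = a} : ℝ) / n - p a) * n| := by rw [abs_mul, abs_of_pos hn']
      _ = _ := by rw [hmean, natCard_eq_sum, sub_mul, div_mul_cancel₀ _ hn'.ne', mul_comm (p a)]

theorem tendsto_mass_not_isTypical [Fintype α] {p : α → ℝ} (hp : p ∈ stdSimplex ℝ α)
    (hδ : 0 < δ) :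
    Tendsto (fun n : ℕ => mass (blockProb p) {x : Fin n → α | ¬ IsTypical δ p x})
      atTop (𝓝 0) := by
  have hsum := tendsto_finsetSum Finset.univ fun a _ => tendsto_mass_letter_deviation hp hδ a
  rw [Finset.sum_const_zero] at hsum
  refine squeeze_zero (fun n => mass_nonneg (blockProb_mem_stdSimplex hp n).1 _) (fun n => ?_) hsum
  refine (mass_mono (blockProb_mem_stdSimplex hp n).1 fun x hx => ?_).trans
    (mass_biUnion_le (blockProb_mem_stdSimplex hp n).1 _ _)
  simpa [IsTypical] using hx

end Typical

section Counting

variable {β γ : Type*} [Fintype β] {q : β → ℝ} {n : ℕ} {δ : ℝ} {y : Fin n → β}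

theorem condProb_id (q : β → ℝ) (g : β → γ) (b : β) : condProb q id g b = q b / law q g (g b) := by
  classical
  have : law q (fun b => (id b, g b)) (id b, g b) = law q id b := law_congr q fun b' => by
    simpa using congrArg g
  rw [condProb, this]
  simp [law, Finset.sum_filter]

theorem law_condProb_id_le_one (q : β → ℝ) (g : β → γ) (c : γ) :
    law (condProb q id g) g c ≤ 1 := by
  classical
  calc law (condProb q id g) g c = law q g c / law q g c := by
        simp only [law, Finset.sum_div]
        refine Finset.sum_congr rfl fun b hb => ?_
        rw [condProb_id, (Finset.mem_filter.1 hb).2, law]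
    _ ≤ 1 := div_self_le_one _

theorem IsTypical.rpow_le_prod_condProb (hq : ∀ b, 0 ≤ q b) (hy : IsTypical δ q y) (g : β → γ) :
    (2 : ℝ) ^ (-(n * ((1 + δ) * condEntropy q id g))) ≤ ∏ t, condProb q id g (y t) := by
  have hpos (t : Fin n) : 0 < condProb q id g (y t) := by
    rw [condProb_id]
    exact div_pos (hy.pos hq t) ((hy.pos hq t).trans_le (le_law hq g _))
  rw [← Real.le_logb_iff_rpow_le one_lt_two (Finset.prod_pos fun t _ => hpos t),
    Real.logb_prod _ _ fun t _ => (hpos t).ne', neg_le, ← Finset.sum_neg_distrib]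
  refine (hy.sum_le fun b => neg_nonneg.2 (Real.logb_nonpos one_lt_two
    (condProb_nonneg hq id g b) (condProb_le_one hq id g b))).trans_eq ?_
  simp only [condEntropy_eq, mul_neg, Finset.sum_neg_distrib]

theorem ncard_typical_le (hq : ∀ b, 0 ≤ q b) (g : β → γ) (v : Fin n → γ) (δ : ℝ) :
    ({y : Fin n → β | IsTypical δ q y ∧ (fun t => g (y t)) = v}.ncard : ℝ)
      ≤ 2 ^ (n * ((1 + δ) * condEntropy q id g)) := by
  have hw : ∀ b, 0 ≤ condProb q id g b := condProb_nonneg hq id g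
  have hmass : mass (blockProb (condProb q id g))
      {y : Fin n → β | IsTypical δ q y ∧ (fun t => g (y t)) = v} ≤ 1 :=
    calc mass (blockProb (condProb q id g))
          {y : Fin n → β | IsTypical δ q y ∧ (fun t => g (y t)) = v}
        ≤ law (blockProb (condProb q id g)) (fun (y : Fin n → β) t => g (y t)) v := by
          rw [law_eq_mass]
          exact mass_mono (fun y => Finset.prod_nonneg fun t _ => hw _) fun y hy => hy.2
      _ = ∏ t, law (condProb q id g) g (v t) := law_blockProb _ _ _
      _ ≤ 1 := Finset.prod_le_one (fun _ _ => law_nonneg hw _ _) fun _ _ =>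
          law_condProb_id_le_one q g _
  have hle := (ncard_mul_le_mass fun y hy => hy.1.rpow_le_prod_condProb hq g).trans hmass
  rwa [Real.rpow_neg zero_le_two, ← div_eq_mul_inv, div_le_one (by positivity)] at hle

end Counting

section Converse

variable {α β γ τ : Type*} [Fintype α] {p : α → ℝ}

theorem mass_le_mul_law (hp : ∀ a, 0 ≤ p a) {f : α → β} {g : α → γ} {E : Set α} {c : γ} {B : ℝ}
    (hB : 0 ≤ B) (hg : ∀ a ∈ E, g a = c) (hf : ∀ a ∈ E, ∀ a' ∈ E, f a = f a')
    (hE : ∀ a ∈ E, condProb p f g a ≤ B) : mass p E ≤ B * law p g c := by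
  rcases E.eq_empty_or_nonempty with rfl | ⟨a₀, ha₀⟩
  · exact mass_empty p ▸ mul_nonneg hB (law_nonneg hp _ _)
  · obtain rfl := hg a₀ ha₀
    calc mass p E ≤ law p (fun a => (f a, g a)) (f a₀, g a₀) := by
          rw [law_eq_mass]
          exact mass_mono hp fun a ha => Prod.ext (hf a ha a₀ ha₀) (hg a ha)
      _ = condProb p f g a₀ * law p g (g a₀) := (condProb_mul_law hp f g a₀).symm
      _ ≤ B * law p g (g a₀) := mul_le_mul_of_nonneg_right (hE a₀ ha₀) (law_nonneg hp _ _)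

theorem mass_le_card_mul_add [Finite γ] [Fintype τ] (hp : p ∈ stdSimplex ℝ α) (f : α → β)
    (g : α → γ) (T : α → τ) {G : Set α}
    (hG : ∀ a ∈ G, ∀ a' ∈ G, T a = T a' → g a = g a' → f a = f a') {B : ℝ} (hB : 0 ≤ B) :
    mass p G ≤ Fintype.card τ * B + mass p {a | B < condProb p f g a} := by
  have := Fintype.ofFinite γ
  have hfiber (c : τ × γ) :
      mass p (G \ {a | B < condProb p f g a} ∩ (fun a => (T a, g a)) ⁻¹' {c})
        ≤ B * law p g c.2 :=
    mass_le_mul_law hp.1 hB (fun a ha => congrArg Prod.snd ha.2)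
      (fun a ha a' ha' => hG a ha.1.1 a' ha'.1.1
        (congrArg Prod.fst (ha.2.trans ha'.2.symm)) (congrArg Prod.snd (ha.2.trans ha'.2.symm)))
      fun a ha => not_lt.1 ha.1.2
  calc mass p G
      ≤ mass p (G \ {a | B < condProb p f g a} ∪ {a | B < condProb p f g a}) :=
        mass_mono hp.1 (Set.subset_sdiff_union _ _)
    _ ≤ mass p (G \ {a | B < condProb p f g a}) + mass p {a | B < condProb p f g a} :=
        mass_union_le hp.1 _ _
    _ ≤ (∑ c : τ × γ, B * law p g c.2) + mass p {a | B < condProb p f g a} := by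
        rw [mass_eq_sum_fiber p (G \ _) fun a => (T a, g a)]
        gcongr with c
        exact hfiber c
    _ = Fintype.card τ * B + mass p {a | B < condProb p f g a} := by
        simp [Fintype.sum_prod_type, ← Finset.mul_sum, sum_law, hp.2, mul_comm]

theorem tendsto_mass_lt_condProb_blockProb (hp : p ∈ stdSimplex ℝ α) (f : α → β) (g : α → γ)
    {r : ℝ} (hr : 0 < r) :
    Tendsto (fun n : ℕ => mass (blockProb p)
      {x : Fin n → α | 2 ^ (-(n * (condEntropy p f g - r)))
        < condProb (blockProb p) (fun x t => f (x t)) (fun x t => g (x t)) x})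
      atTop (𝓝 0) := by
  refine squeeze_zero (fun n => mass_nonneg (blockProb_mem_stdSimplex hp n).1 _)
    (fun n => mass_mono (blockProb_mem_stdSimplex hp n).1 fun x hx => ?_)
    (tendsto_mass_deviation hp (fun a => Real.logb 2 (condProb p f g a)) hr)
  rw [Set.mem_ofPred_eq, condProb_blockProb] at hx
  have hprod : 0 < ∏ t, condProb p f g (x t) := (by positivity : (0 : ℝ) < _).trans hx
  rw [← Real.lt_logb_iff_rpow_lt one_lt_two hprod,
    Real.logb_prod _ _ (Finset.prod_ne_zero_iff.1 hprod.ne')] at hx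
  rw [condEntropy_eq] at hx
  refine le_trans ?_ (le_abs_self (_ : ℝ))
  linarith

end Converse

section Rates

theorem prod_two_rpow_mul {ι : Type*} (s : Finset ι) (c : ℝ) (ρ : ι → ℝ) :
    ∏ q ∈ s, (2 : ℝ) ^ (c * ρ q) = 2 ^ (c * ∑ q ∈ s, ρ q) := by
  rw [← Real.rpow_sum_of_pos two_pos, Finset.mul_sum]

theorem one_div_mul_logb_le_iff {n : ℕ} (hn : 0 < n) {ℓ ρ : ℝ} (hℓ : 0 < ℓ) :
    1 / (n : ℝ) * Real.logb 2 ℓ ≤ ρ ↔ ℓ ≤ 2 ^ (n * ρ) := by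
  rw [one_div, inv_mul_le_iff₀ (by positivity), Real.logb_le_iff_le_rpow one_lt_two hℓ]

theorem tendsto_two_rpow_neg_mul {r : ℝ} (hr : 0 < r) :
    Tendsto (fun n : ℕ => (2 : ℝ) ^ (-(n * r))) atTop (𝓝 0) :=
  (tendsto_rpow_atBot_of_base_gt_one 2 one_lt_two).comp
    (tendsto_neg_atTop_atBot.comp (tendsto_natCast_atTop_atTop.atTop_mul_const hr))

end Rates

section Packets

variable {N M : ℕ} {𝒳 : Fin N → Type*} {Sig : Fin M → Finset (Fin N)}

/-- The packets that sink `j` receives from the sources in `S`, as pairs of a source and a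
destination set. -/
def packetsTo (Sig : Fin M → Finset (Fin N)) (j : Fin M) (S : Finset (Fin N)) :
    Finset (Σ i, noHelperPackets Sig i) :=
  S.sigma fun _ => {K | j ∈ K.1}

theorem mem_packetsTo {j : Fin M} {S : Finset (Fin N)} {q : Σ i, noHelperPackets Sig i} :
    q ∈ packetsTo Sig j S ↔ q.1 ∈ S ∧ j ∈ q.2.1 := by
  simp [packetsTo]

theorem mem_noHelperPackets {i : Fin N} {K : Finset (Fin M)} :
    K ∈ noHelperPackets Sig i ↔ K.Nonempty ∧ ∀ j ∈ K, i ∈ Sig j := by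
  simp [noHelperPackets, requesters, Finset.subset_iff]

theorem packetsTo_nonempty {j : Fin M} {S : Finset (Fin N)} (hS : S ⊆ Sig j) (hne : S.Nonempty) :
    (packetsTo Sig j S).Nonempty := by
  obtain ⟨i, hi⟩ := hne
  have hj : {j} ∈ noHelperPackets Sig i := mem_noHelperPackets.2 (by simpa using hS hi)
  exact ⟨⟨i, {j}, hj⟩, mem_packetsTo.2 ⟨hi, Finset.mem_singleton_self j⟩⟩

variable [∀ i, Fintype (𝒳 i)]

/-- The entropy `H(X_S | X_{Sig j \ S})` that bounds from below the total rate of the packets from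
the sources in `S` to sink `j`. -/
noncomputable def sinkEntropy (p : (∀ i, 𝒳 i) → ℝ) (Sig : Fin M → Finset (Fin N)) (j : Fin M)
    (S : Finset (Fin N)) : ℝ :=
  condEntropy p (S.restrict (π := 𝒳)) ((Sig j \ S).restrict (π := 𝒳))

theorem mem_noHelperRegion_iff {p : (∀ i, 𝒳 i) → ℝ} {R : ∀ i, noHelperPackets Sig i → ℝ} :
    R ∈ noHelperRegion p Sig ↔ (∀ i K, 0 ≤ R i K) ∧ ∀ j, ∀ S ⊆ Sig j, S.Nonempty →
      sinkEntropy p Sig j S ≤ ∑ q ∈ packetsTo Sig j S, R q.1 q.2 := by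
  simp only [packetsTo, Finset.sum_sigma]
  rfl

end Packets

section CodeError

variable {N M n : ℕ} {𝒳 : Fin N → Type*} {Sig : Fin M → Finset (Fin N)}
  {pk : Fin N → Finset (Finset (Fin M))}

/-- The source blocks that sink `j` fails to reconstruct. -/
def Code.errorSet (c : Code 𝒳 Sig pk n) (j : Fin M) : Set (Fin n → ∀ i, 𝒳 i) :=
  {x | c.estimate j x ≠ fun (i : Sig j) t => x t i}

theorem Code.prod_L_le (c : Code 𝒳 Sig pk n) (hn : 0 < n) {ρ : ∀ i, pk i → ℝ}
    (hρ : ∀ i K, 1 / (n : ℝ) * Real.logb 2 (c.L i K) ≤ ρ i K) (s : Finset (Σ i, pk i)) :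
    ∏ q ∈ s, (c.L q.1 q.2 : ℝ) ≤ 2 ^ (n * ∑ q ∈ s, ρ q.1 q.2) := by
  rw [← prod_two_rpow_mul]
  gcongr with q
  exact (one_div_mul_logb_le_iff hn (mod_cast (c.L q.1 q.2).pos)).1 (hρ q.1 q.2)

variable [∀ i, Fintype (𝒳 i)] {p : (∀ i, 𝒳 i) → ℝ}

theorem Code.errorProb_eq (p : (∀ i, 𝒳 i) → ℝ) (c : Code 𝒳 Sig pk n) :
    c.errorProb p = 1 / (M : ℝ) * ∑ j, mass (blockProb p) (c.errorSet j) := by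
  classical
  simp only [errorProb, errorSet, mass_setOf]

theorem Code.mass_errorSet_le (hp : p ∈ stdSimplex ℝ (∀ i, 𝒳 i)) (c : Code 𝒳 Sig pk n)
    (j : Fin M) : mass (blockProb p) (c.errorSet j) ≤ M * c.errorProb p := by
  have hM : (M : ℝ) ≠ 0 := mod_cast j.pos.ne'
  rw [c.errorProb_eq, one_div, mul_inv_cancel_left₀ hM]
  exact Finset.single_le_sum (f := fun j => mass (blockProb p) (c.errorSet j))
    (fun j _ => mass_nonneg (blockProb_mem_stdSimplex hp n).1 _) (Finset.mem_univ j)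

end CodeError

section Converse

variable {N M n : ℕ} {𝒳 : Fin N → Type*} {Sig : Fin M → Finset (Fin N)}

theorem Code.estimate_congr (c : Code 𝒳 Sig (noHelperPackets Sig) n) {j : Fin M}
    {x x' : Fin n → ∀ i, 𝒳 i}
    (h : ∀ q ∈ packetsTo Sig j (Sig j),
      c.enc q.1 (fun t => x t q.1) q.2 = c.enc q.1 (fun t => x' t q.1) q.2) :
    c.estimate j x = c.estimate j x' :=
  congrArg (c.dec j) <| funext fun i => funext fun K =>
    h ⟨i, K.1⟩ (mem_packetsTo.2 ⟨(mem_noHelperPackets.1 K.1.2).2 j K.2, K.2⟩)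

variable [∀ i, Fintype (𝒳 i)] {p : (∀ i, 𝒳 i) → ℝ}

theorem Code.mass_compl_errorSet_le (hp : p ∈ stdSimplex ℝ (∀ i, 𝒳 i))
    (c : Code 𝒳 Sig (noHelperPackets Sig) n) {j : Fin M} {S : Finset (Fin N)} (hS : S ⊆ Sig j)
    {B : ℝ} (hB : 0 ≤ B) :
    mass (blockProb p) (c.errorSet j)ᶜ ≤ (∏ q ∈ packetsTo Sig j S, (c.L q.1 q.2 : ℝ)) * B +
      mass (blockProb p) {x : Fin n → ∀ i, 𝒳 i | B < condProb (blockProb p)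
        (fun x t => S.restrict (x t)) (fun x t => (Sig j \ S).restrict (x t)) x} := by
  have hcard : ∏ q ∈ packetsTo Sig j S, (c.L q.1 q.2 : ℝ)
      = Fintype.card (∀ q : packetsTo Sig j S, Fin (c.L q.1.1 q.1.2)) := by
    rw [← Finset.prod_coe_sort]
    simp
  rw [hcard]
  refine mass_le_card_mul_add (blockProb_mem_stdSimplex hp n) _ _
    (fun x (q : packetsTo Sig j S) => c.enc q.1.1 (fun t => x t q.1.1) q.1.2)
    (fun x hx x' hx' hT hside => ?_) hB
  have hest : c.estimate j x = c.estimate j x' := c.estimate_congr fun q hq => by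
    obtain ⟨hqj, hjq⟩ := mem_packetsTo.1 hq
    by_cases hqS : q.1 ∈ S
    · exact congrFun hT ⟨q, mem_packetsTo.2 ⟨hqS, hjq⟩⟩
    · have hsame (t : Fin n) : x t q.1 = x' t q.1 :=
        congrFun (congrFun hside t) ⟨q.1, Finset.mem_sdiff.2 ⟨hqj, hqS⟩⟩
      simp only [hsame]
  rw [not_not.1 hx, not_not.1 hx'] at hest
  exact funext fun t => funext fun i => congrFun (congrFun hest ⟨i, hS i.2⟩) t

theorem Achievable.sinkEntropy_le_add (hp : p ∈ stdSimplex ℝ (∀ i, 𝒳 i))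
    {R : ∀ i, noHelperPackets Sig i → ℝ} (h : Achievable p Sig (noHelperPackets Sig) R)
    {j : Fin M} {S : Finset (Fin N)} (hS : S ⊆ Sig j) {η : ℝ} (hη : 0 < η) :
    sinkEntropy p Sig j S ≤ ∑ q ∈ packetsTo Sig j S, (R q.1 q.2 + η) + 2 * η := by
  by_contra! hlt
  have hM : (1 : ℝ) ≤ M := mod_cast j.pos
  obtain ⟨n₀, hn₀⟩ := h η hη (1 / (2 * M)) (by positivity) (by
    rw [div_lt_one (by positivity)]
    linarith)
  have hlim := (tendsto_two_rpow_neg_mul hη).add (tendsto_mass_lt_condProb_blockProb hp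
    (S.restrict (π := 𝒳)) ((Sig j \ S).restrict (π := 𝒳)) hη)
  rw [add_zero] at hlim
  obtain ⟨n, hsmall, hn, hpos⟩ := ((hlim.eventually_lt_const one_half_pos).and
    ((eventually_ge_atTop n₀).and (eventually_gt_atTop 0))).exists
  obtain ⟨c, hrate, herror⟩ := hn₀ n hn
  have hcorrect : mass (blockProb p) (c.errorSet j)ᶜ < 1 / 2 := by
    refine (c.mass_compl_errorSet_le hp hS (B := 2 ^ (-(n * (sinkEntropy p Sig j S - η))))
      (by positivity)).trans_lt (hsmall.trans_le' (add_le_add_left ?_ _))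
    calc (∏ q ∈ packetsTo Sig j S, (c.L q.1 q.2 : ℝ)) *
          2 ^ (-(n * (sinkEntropy p Sig j S - η)))
        ≤ 2 ^ (n * ∑ q ∈ packetsTo Sig j S, (R q.1 q.2 + η)) *
          2 ^ (-(n * (sinkEntropy p Sig j S - η))) := by
          gcongr
          exact c.prod_L_le hpos hrate _
      _ = 2 ^ (n * (∑ q ∈ packetsTo Sig j S, (R q.1 q.2 + η) - sinkEntropy p Sig j S + η)) := by
          rw [← Real.rpow_add two_pos]
          congr 1
          ring
      _ ≤ 2 ^ (-(n * η)) := by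
          rw [← mul_neg]
          gcongr
          · exact one_le_two
          · linarith
  have hwrong : mass (blockProb p) (c.errorSet j) < 1 / 2 :=
    calc mass (blockProb p) (c.errorSet j) ≤ M * c.errorProb p := c.mass_errorSet_le hp j
      _ < M * (1 / (2 * M)) := by gcongr
      _ = 1 / 2 := by field_simp
  rw [mass_compl, (blockProb_mem_stdSimplex hp n).2] at hcorrect
  linarith

theorem Achievable.nonneg {R : ∀ i, noHelperPackets Sig i → ℝ}
    (h : Achievable p Sig (noHelperPackets Sig) R) (i : Fin N) (K : noHelperPackets Sig i) :
    0 ≤ R i K := by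
  refine le_of_forall_pos_le_add fun η hη => ?_
  obtain ⟨n, hn⟩ := h η hη (1 / 2) one_half_pos one_half_lt_one
  obtain ⟨c, hrate, -⟩ := hn n le_rfl
  have hlog : 0 ≤ Real.logb 2 (c.L i K) := Real.logb_nonneg one_lt_two (mod_cast (c.L i K).pos)
  exact le_trans (by positivity) (hrate i K)

theorem Achievable.mem_noHelperRegion (hp : p ∈ stdSimplex ℝ (∀ i, 𝒳 i))
    {R : ∀ i, noHelperPackets Sig i → ℝ} (h : Achievable p Sig (noHelperPackets Sig) R) :
    R ∈ noHelperRegion p Sig := by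
  refine mem_noHelperRegion_iff.2 ⟨h.nonneg, fun j S hS _ => ?_⟩
  have hcont : Continuous fun η : ℝ => ∑ q ∈ packetsTo Sig j S, (R q.1 q.2 + η) + 2 * η := by
    fun_prop
  have hlim := (hcont.tendsto 0).mono_left (nhdsWithin_le_nhds (s := Set.Ioi 0))
  simp only [add_zero, mul_zero] at hlim
  exact ge_of_tendsto hlim
    (eventually_mem_nhdsWithin.mono fun η hη => h.sinkEntropy_le_add hp hS hη)

end Converse

section RandomHashing

/-- The uniform probability mass function on a finite type, the law of a random binning. -/
noncomputable def uniform (α : Type*) [Fintype α] (_ : α) : ℝ := (Fintype.card α : ℝ)⁻¹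

theorem uniform_mem_stdSimplex (α : Type*) [Fintype α] [Nonempty α] :
    uniform α ∈ stdSimplex ℝ α :=
  ⟨fun _ => inv_nonneg.2 (Nat.cast_nonneg _), by simp [uniform]⟩

theorem mass_uniform_le_of_injective {α C : Type*} [Fintype α] [Fintype C] [Nonempty C]
    {E : Set α} {φ : E × C → α} (hφ : φ.Injective) :
    mass (uniform α) E ≤ (Fintype.card C : ℝ)⁻¹ := by
  classical
  have hcard : (Fintype.card E * Fintype.card C : ℝ) ≤ Fintype.card α :=
    mod_cast Fintype.card_prod E C ▸ Fintype.card_le_of_injective φ hφ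
  have hmass : mass (uniform α) E = Fintype.card E / Fintype.card α := by
    simp [mass, uniform, Set.indicator_apply, Finset.sum_ite, div_eq_mul_inv, Fintype.card_subtype]
  have hC : (0 : ℝ) < Fintype.card C := mod_cast Fintype.card_pos
  rw [hmass]
  refine div_le_of_le_mul₀ (Nat.cast_nonneg _) (inv_nonneg.2 hC.le) ?_
  rwa [le_inv_mul_iff₀ hC, mul_comm]

theorem mass_uniform_agree_le {ι : Type*} {D κ : ι → Type*} {L : ∀ i, κ i → ℕ+}
    [Fintype (∀ i, D i → ∀ K, Fin (L i K))] {s : Finset (Σ i, κ i)} {x z : ∀ i, D i}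
    (h : ∀ q ∈ s, x q.1 ≠ z q.1) :
    mass (uniform (∀ i, D i → ∀ K, Fin (L i K)))
      {b | ∀ q ∈ s, b q.1 (z q.1) q.2 = b q.1 (x q.1) q.2} ≤ (∏ q ∈ s, (L q.1 q.2 : ℝ))⁻¹ := by
  classical
  have hcard : ∏ q ∈ s, (L q.1 q.2 : ℝ) = Fintype.card (∀ q : s, Fin (L q.1.1 q.1.2)) := by
    rw [← Finset.prod_coe_sort]
    simp
  have : Nonempty (∀ q : s, Fin (L q.1.1 q.1.2)) := ⟨fun q => ⟨0, (L q.1.1 q.1.2).pos⟩⟩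
  rw [hcard]
  -- Redrawing the indices `b q.1 (z q.1) q.2`, `q ∈ s`, is injective on agreeing assignments, since
  -- the erased indices are still recorded at `x`.
  refine mass_uniform_le_of_injective (φ := fun bc i y K =>
    if hq : y = z i ∧ (⟨i, K⟩ : Σ i, κ i) ∈ s then bc.2 ⟨⟨i, K⟩, hq.2⟩ else bc.1.1 i y K) ?_
  rintro ⟨⟨b, hb⟩, c⟩ ⟨⟨b', hb'⟩, c'⟩ heq
  simp only [funext_iff] at heq
  have hc : c = c' := funext fun q => by simpa using heq q.1.1 (z q.1.1) q.1.2
  have hbb : b = b' := by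
    funext i y K
    by_cases hq : y = z i ∧ (⟨i, K⟩ : Σ i, κ i) ∈ s
    · obtain ⟨rfl, hs⟩ := hq
      have hx := heq i (x i) K
      simp only [h _ hs, false_and, dif_neg, not_false_eq_true] at hx
      rw [hb _ hs, hb' _ hs, hx]
    · simpa [hq] using heq i y K
  subst hc hbb
  rfl

end RandomHashing

section Rivals

variable {N M n : ℕ} {𝒳 : Fin N → Type*} {Sig : Fin M → Finset (Fin N)} [∀ i, Fintype (𝒳 i)]
  {p : (∀ i, 𝒳 i) → ℝ} {δ : ℝ} {j : Fin M} {S : Finset (Fin N)} {x : Fin n → ∀ i, 𝒳 i}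

/-- The blocks that are typical for sink `j` and differ from `x` in exactly the sources of `S`:
those that can be mistaken for `x`. -/
def rivals (p : (∀ i, 𝒳 i) → ℝ) (Sig : Fin M → Finset (Fin N)) (δ : ℝ) (j : Fin M)
    (S : Finset (Fin N)) (x : Fin n → ∀ i, 𝒳 i) : Set (Fin n → ∀ i, 𝒳 i) :=
  {y | IsTypical δ (law p ((Sig j).restrict (π := 𝒳))) (fun t => (Sig j).restrict (y t)) ∧
    ∀ i, i ∈ S ↔ (fun t => x t i) ≠ fun t => y t i}

theorem eq_of_mem_rivals {y : Fin n → ∀ i, 𝒳 i} (hy : y ∈ rivals p Sig δ j S x) {i : Fin N}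
    (hi : i ∉ S) (t : Fin n) : y t i = x t i :=
  (congrFun (not_not.1 fun hne => hi ((hy.2 i).2 hne)) t).symm

theorem condEntropy_law_restrict (p : (∀ i, 𝒳 i) → ℝ) (hS : S ⊆ Sig j) :
    condEntropy (law p ((Sig j).restrict (π := 𝒳))) id
      (Finset.restrict₂ (π := 𝒳) (Finset.sdiff_subset : Sig j \ S ⊆ Sig j))
      = sinkEntropy p Sig j S := by
  rw [condEntropy_law_id]
  refine condEntropy_congr_left p fun a a' hside => ?_
  simp only [funext_iff, Subtype.forall, Finset.restrict, Finset.restrict₂, Finset.mem_sdiff]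
    at hside ⊢
  exact ⟨fun h i hi => h i (hS hi), fun h i hi => if hiS : i ∈ S then h i hiS
    else hside i ⟨hi, hiS⟩⟩

theorem ncard_rivals_le (hp : ∀ a, 0 ≤ p a) (hS : S ⊆ Sig j) (δ : ℝ) (x : Fin n → ∀ i, 𝒳 i) :
    ((rivals p Sig δ j S x).ncard : ℝ) ≤ 2 ^ (n * ((1 + δ) * sinkEntropy p Sig j S)) := by
  rw [← condEntropy_law_restrict p hS]
  refine le_trans ?_ (ncard_typical_le (law_nonneg hp _) (Finset.restrict₂ Finset.sdiff_subset)
    (fun t => (Sig j \ S).restrict (x t)) δ)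
  refine Nat.cast_le.2 (Set.ncard_le_ncard_of_injOn (fun y t => (Sig j).restrict (y t))
    (fun y hy => ⟨hy.1, ?_⟩) ?_)
  · exact funext fun t => funext fun i => eq_of_mem_rivals hy (Finset.mem_sdiff.1 i.2).2 t
  · intro y hy y' hy' heq
    funext t i
    by_cases hi : i ∈ S
    · exact congrFun (congrFun heq t) ⟨i, hS hi⟩
    · rw [eq_of_mem_rivals hy hi, eq_of_mem_rivals hy' hi]

/-- The binnings under which some rival of `x` differing from it in the sources of `S` shares with
`x` all bin indices that sink `j` receives from these sources. -/
def collisionSet (p : (∀ i, 𝒳 i) → ℝ) (Sig : Fin M → Finset (Fin N)) (δ : ℝ)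
    (L : ∀ i, noHelperPackets Sig i → ℕ+) (j : Fin M) (S : Finset (Fin N))
    (x : Fin n → ∀ i, 𝒳 i) : Set (Binning 𝒳 Sig n L) :=
  {b | ∃ y ∈ rivals p Sig δ j S x, ∀ q ∈ packetsTo Sig j S,
    b q.1 (fun t => y t q.1) q.2 = b q.1 (fun t => x t q.1) q.2}

theorem mass_collisionSet_le {L : ∀ i, noHelperPackets Sig i → ℕ+}
    [Fintype (Binning 𝒳 Sig n L)] (hp : ∀ a, 0 ≤ p a) (hS : S ⊆ Sig j) (δ : ℝ)
    (x : Fin n → ∀ i, 𝒳 i) :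
    mass (uniform (Binning 𝒳 Sig n L)) (collisionSet p Sig δ L j S x)
      ≤ 2 ^ (n * ((1 + δ) * sinkEntropy p Sig j S))
        * (∏ q ∈ packetsTo Sig j S, (L q.1 q.2 : ℝ))⁻¹ := by
  have hfin : (rivals p Sig δ j S x).Finite := Set.toFinite _
  have hunif (b : Binning 𝒳 Sig n L) : 0 ≤ uniform (Binning 𝒳 Sig n L) b :=
    inv_nonneg.2 (Nat.cast_nonneg _)
  calc mass (uniform (Binning 𝒳 Sig n L)) (collisionSet p Sig δ L j S x)
      ≤ mass (uniform (Binning 𝒳 Sig n L)) (⋃ y ∈ hfin.toFinset, {b | ∀ q ∈ packetsTo Sig j S,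
          b q.1 (fun t => y t q.1) q.2 = b q.1 (fun t => x t q.1) q.2}) :=
        mass_mono hunif fun b hb => by simpa [collisionSet] using hb
    _ ≤ ∑ _y ∈ hfin.toFinset, (∏ q ∈ packetsTo Sig j S, (L q.1 q.2 : ℝ))⁻¹ := by
        refine (mass_biUnion_le hunif _ _).trans (Finset.sum_le_sum fun y hy => ?_)
        exact mass_uniform_agree_le (x := fun i t => x t i) (z := fun i t => y t i) fun q hq =>
          ((hfin.mem_toFinset.1 hy).2 q.1).1 (mem_packetsTo.1 hq).1
    _ = (rivals p Sig δ j S x).ncard * (∏ q ∈ packetsTo Sig j S, (L q.1 q.2 : ℝ))⁻¹ := by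
        rw [Finset.sum_const, nsmul_eq_mul, Set.ncard_eq_toFinset_card _ hfin]
    _ ≤ _ := by
        gcongr
        exact ncard_rivals_le hp hS δ x

end Rivals

section BinningError

variable {N M n : ℕ} {𝒳 : Fin N → Type*} {Sig : Fin M → Finset (Fin N)} [∀ i, Fintype (𝒳 i)]
  [∀ i, Nonempty (𝒳 i)] {p : (∀ i, 𝒳 i) → ℝ} {δ : ℝ} {L : ∀ i, noHelperPackets Sig i → ℕ+}
  {j : Fin M} {x : Fin n → ∀ i, 𝒳 i}

theorem powerBinningCode_estimate_eq (hx : IsTypical δ p x) (b : Binning 𝒳 Sig n L)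
    (huniq : ∀ z, BinMatch p δ b j (fun i K => b i (fun t => x t i) K.1) z →
      z = fun (i : Sig j) t => x t i) :
    (powerBinningCode p δ b).estimate j x = fun (i : Sig j) t => x t i := by
  have hsent (i : Fin N) (K : noHelperPackets Sig i) :
      (powerBinningCode p δ b).enc i (fun t => x t i) K = b i (fun t => x t i) K :=
    if_pos (hx.map fun a => a i)
  have hmatch : ∃! z, BinMatch p δ b j (fun i K => b i (fun t => x t i) K.1) z :=
    ⟨fun (i : Sig j) t => x t i, ⟨hx.map _, fun _ _ => rfl⟩, huniq⟩
  simp only [Code.estimate, hsent]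
  exact (dif_pos hmatch).trans (huniq _ hmatch.choose_spec.1)

theorem exists_mem_collisionSet (hx : IsTypical δ p x) {b : Binning 𝒳 Sig n L}
    (hb : x ∈ (powerBinningCode p δ b).errorSet j) :
    ∃ S ⊆ Sig j, S.Nonempty ∧ b ∈ collisionSet p Sig δ L j S x := by
  classical
  obtain ⟨z, hz, hne⟩ : ∃ z, BinMatch p δ b j (fun i K => b i (fun t => x t i) K.1) z ∧
      z ≠ fun (i : Sig j) t => x t i := by
    by_contra! huniq
    exact hb (powerBinningCode_estimate_eq hx b huniq)
  let y : Fin n → ∀ i, 𝒳 i := fun t i => if hi : i ∈ Sig j then z ⟨i, hi⟩ t else x t i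
  have hyz (i : Sig j) : (fun t => y t i) = z i := funext fun t => dif_pos i.2
  have hyx {i : Fin N} (hi : i ∉ Sig j) : (fun t => y t i) = fun t => x t i :=
    funext fun t => dif_neg hi
  have hS : ({i | (fun t => x t i) ≠ fun t => y t i} : Finset (Fin N)) ⊆ Sig j := fun i hi => by
    by_contra hij
    exact (Finset.mem_filter.1 hi).2 (hyx hij).symm
  refine ⟨_, hS, ?_, y, ⟨?_, fun i => by simp⟩, fun q hq => ?_⟩
  · obtain ⟨i, hi⟩ := Function.ne_iff.1 hne
    exact ⟨i, Finset.mem_filter.2 ⟨Finset.mem_univ _, fun h => hi ((hyz i).symm.trans h.symm)⟩⟩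
  · convert hz.1 using 3 with t i
    exact congrFun (hyz i) t
  · obtain ⟨hqS, hjq⟩ := mem_packetsTo.1 hq
    rw [hyz ⟨q.1, hS hqS⟩]
    exact hz.2 ⟨q.1, hS hqS⟩ ⟨q.2, hjq⟩

/-- The probability, over a uniformly random binning, that sink `j` fails to reconstruct the source
block `x`. -/
noncomputable def binningErrorProb (p : (∀ i, 𝒳 i) → ℝ) (δ : ℝ)
    (L : ∀ i, noHelperPackets Sig i → ℕ+) (j : Fin M) (x : Fin n → ∀ i, 𝒳 i) : ℝ :=
  open Classical in
  mass (uniform (Binning 𝒳 Sig n L)) {b | x ∈ (powerBinningCode p δ b).errorSet j}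

theorem binningErrorProb_le_one (p : (∀ i, 𝒳 i) → ℝ) (δ : ℝ)
    (L : ∀ i, noHelperPackets Sig i → ℕ+) (j : Fin M) (x : Fin n → ∀ i, 𝒳 i) :
    binningErrorProb p δ L j x ≤ 1 := by
  classical
  have : Nonempty (Binning 𝒳 Sig n L) := ⟨fun i _ K => ⟨0, (L i K).pos⟩⟩
  exact mass_le_one (uniform_mem_stdSimplex _) _

theorem binningErrorProb_le (hp : ∀ a, 0 ≤ p a) (hx : IsTypical δ p x) {u : ℝ} (hu : 0 ≤ u)
    (h : ∀ S ⊆ Sig j, S.Nonempty → 2 ^ (n * ((1 + δ) * sinkEntropy p Sig j S))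
      * (∏ q ∈ packetsTo Sig j S, (L q.1 q.2 : ℝ))⁻¹ ≤ u) :
    binningErrorProb p δ L j x ≤ 2 ^ N * u := by
  classical
  have hunif (b : Binning 𝒳 Sig n L) : 0 ≤ uniform (Binning 𝒳 Sig n L) b :=
    inv_nonneg.2 (Nat.cast_nonneg _)
  calc binningErrorProb p δ L j x
      ≤ mass (uniform (Binning 𝒳 Sig n L))
          (⋃ S ∈ {S ∈ (Sig j).powerset | S.Nonempty}, collisionSet p Sig δ L j S x) := by
        refine mass_mono hunif fun b hb => ?_
        obtain ⟨S, hS, hne, hbS⟩ := exists_mem_collisionSet hx hb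
        exact Set.mem_biUnion (Finset.mem_filter.2 ⟨Finset.mem_powerset.2 hS, hne⟩) hbS
    _ ≤ ∑ _S ∈ {S ∈ (Sig j).powerset | S.Nonempty}, u := by
        refine (mass_biUnion_le hunif _ _).trans (Finset.sum_le_sum fun S hS => ?_)
        obtain ⟨hS, hne⟩ := Finset.mem_filter.1 hS
        have hS := Finset.mem_powerset.1 hS
        exact (mass_collisionSet_le hp hS δ x).trans (h S hS hne)
    _ ≤ ∑ _S : Finset (Fin N), u :=
        Finset.sum_le_sum_of_subset_of_nonneg (Finset.subset_univ _) fun _ _ _ => hu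
    _ = 2 ^ N * u := by simp

theorem powerBinningError_eq (p : (∀ i, 𝒳 i) → ℝ) (n : ℕ) (δ : ℝ)
    (L : ∀ i, noHelperPackets Sig i → ℕ+) :
    powerBinningError p Sig n δ L
      = 1 / (M : ℝ) * ∑ j, ∑ x : Fin n → ∀ i, 𝒳 i,
        blockProb p x * binningErrorProb p δ L j x := by
  classical
  simp only [powerBinningError, binningErrorProb, Code.errorProb_eq, mass, uniform,
    Set.indicator_apply, Set.mem_ofPred_eq, Finset.mul_sum]
  rw [Finset.sum_comm]
  refine Finset.sum_congr rfl fun j _ => ?_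
  rw [Finset.sum_comm]
  refine Finset.sum_congr rfl fun x _ => Finset.sum_congr rfl fun b _ => ?_
  split_ifs <;> ring

theorem powerBinningError_le (hp : p ∈ stdSimplex ℝ (∀ i, 𝒳 i)) {u : ℝ} (hu : 0 ≤ u)
    (h : ∀ j, ∀ x : Fin n → ∀ i, 𝒳 i, IsTypical δ p x → binningErrorProb p δ L j x ≤ u) :
    powerBinningError p Sig n δ L
      ≤ mass (blockProb p) {x : Fin n → ∀ i, 𝒳 i | ¬ IsTypical δ p x} + u := by
  have hblock := blockProb_mem_stdSimplex hp n
  have hnonneg : 0 ≤ mass (blockProb p) {x : Fin n → ∀ i, 𝒳 i | ¬ IsTypical δ p x} + u :=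
    add_nonneg (mass_nonneg hblock.1 _) hu
  rw [powerBinningError_eq, one_div_mul_eq_div]
  refine div_le_of_le_mul₀ (Nat.cast_nonneg _) hnonneg ?_
  calc ∑ j, ∑ x, blockProb p x * binningErrorProb p δ L j x
      ≤ ∑ _j : Fin M, (mass (blockProb p) {x : Fin n → ∀ i, 𝒳 i | ¬ IsTypical δ p x} + u) :=
        Finset.sum_le_sum fun j _ => sum_mul_le_mass_add hblock
          (binningErrorProb_le_one p δ L j) hu fun x hx => h j x (not_not.1 hx)
    _ = _ := by rw [Finset.sum_const, Finset.card_univ, Fintype.card_fin, nsmul_eq_mul, mul_comm]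

end BinningError

section BinNumbers

variable {N M n : ℕ} {𝒳 : Fin N → Type*} {Sig : Fin M → Finset (Fin N)} [∀ i, Fintype (𝒳 i)]
  {p : (∀ i, 𝒳 i) → ℝ} {δ : ℝ}

theorem eventually_exists_two_rpow_le_and_logb_le {a b : ℝ} (ha : 0 ≤ a) (hab : a < b) :
    ∀ᶠ n : ℕ in atTop, ∃ ℓ : ℕ+, (2 : ℝ) ^ (n * a) ≤ ℓ ∧ 1 / (n : ℝ) * Real.logb 2 ℓ ≤ b := by
  have hgap : ∀ᶠ n : ℕ in atTop, 1 ≤ n * (b - a) :=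
    (tendsto_natCast_atTop_atTop.atTop_mul_const (sub_pos.2 hab)).eventually_ge_atTop 1
  filter_upwards [hgap, eventually_gt_atTop 0] with n hn hpos
  have hone : (1 : ℝ) ≤ 2 ^ (n * a) := Real.one_le_rpow one_le_two (by positivity)
  refine ⟨⟨⌈(2 : ℝ) ^ (n * a)⌉₊, Nat.ceil_pos.2 (by positivity)⟩, Nat.le_ceil _, ?_⟩
  rw [one_div_mul_logb_le_iff hpos (mod_cast PNat.pos _), PNat.mk_coe]
  calc (⌈(2 : ℝ) ^ (n * a)⌉₊ : ℝ) ≤ 2 * 2 ^ (n * a) := Nat.ceil_le_two_mul (by linarith)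
    _ = 2 ^ (1 + n * a) := by rw [Real.rpow_add two_pos, Real.rpow_one]
    _ ≤ 2 ^ (n * b) := Real.rpow_le_rpow_of_exponent_le one_le_two (by linarith)

theorem two_rpow_mul_inv_prod_le {R : ∀ i, noHelperPackets Sig i → ℝ} {j : Fin M}
    {S : Finset (Fin N)} {L : ∀ i, noHelperPackets Sig i → ℕ+} (hR : R ∈ noHelperRegion p Sig)
    (hS : S ⊆ Sig j) (hne : S.Nonempty) {η : ℝ} (hη : 0 ≤ η)
    (hL : ∀ i K, (2 : ℝ) ^ (n * (R i K + η)) ≤ L i K) (hδ : δ * sinkEntropy p Sig j S ≤ η / 2) :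
    2 ^ (n * ((1 + δ) * sinkEntropy p Sig j S)) * (∏ q ∈ packetsTo Sig j S, (L q.1 q.2 : ℝ))⁻¹
      ≤ 2 ^ (-(n * (η / 2))) := by
  have hrate : sinkEntropy p Sig j S + η ≤ ∑ q ∈ packetsTo Sig j S, (R q.1 q.2 + η) := by
    have hcard : (1 : ℝ) ≤ (packetsTo Sig j S).card :=
      mod_cast (packetsTo_nonempty hS hne).card_pos
    rw [Finset.sum_add_distrib, Finset.sum_const, nsmul_eq_mul]
    exact add_le_add ((mem_noHelperRegion_iff.1 hR).2 j S hS hne) (le_mul_of_one_le_left hη hcard)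
  calc 2 ^ (n * ((1 + δ) * sinkEntropy p Sig j S)) * (∏ q ∈ packetsTo Sig j S, (L q.1 q.2 : ℝ))⁻¹
      ≤ 2 ^ (n * ((1 + δ) * sinkEntropy p Sig j S)) *
        (∏ q ∈ packetsTo Sig j S, (2 : ℝ) ^ (n * (R q.1 q.2 + η)))⁻¹ := by
        gcongr with q
        exact hL q.1 q.2
    _ = 2 ^ (n * ((1 + δ) * sinkEntropy p Sig j S - ∑ q ∈ packetsTo Sig j S, (R q.1 q.2 + η))) := by
        rw [prod_two_rpow_mul, ← Real.rpow_neg zero_le_two, ← Real.rpow_add two_pos, mul_sub,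
          sub_eq_add_neg]
    _ ≤ 2 ^ (-(n * (η / 2))) := by
        rw [← mul_neg]
        gcongr
        · exact one_le_two
        · linarith

theorem exists_pos_forall_mul_sinkEntropy_le (p : (∀ i, 𝒳 i) → ℝ)
    (Sig : Fin M → Finset (Fin N)) {η : ℝ} (hη : 0 < η) :
    ∃ δ₀ : ℝ, 0 < δ₀ ∧ ∀ δ, 0 < δ → δ < δ₀ → ∀ j S, δ * sinkEntropy p Sig j S ≤ η := by
  have hsmall : ∀ᶠ δ : ℝ in 𝓝 0, ∀ j S, δ * sinkEntropy p Sig j S ≤ η := by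
    refine eventually_all.2 fun j => eventually_all.2 fun S => ?_
    have hlim := (continuous_mul_const (sinkEntropy p Sig j S)).tendsto 0
    rw [zero_mul] at hlim
    exact (hlim.eventually_lt_const hη).mono fun _ => le_of_lt
  obtain ⟨δ₀, hδ₀, h⟩ := (nhdsGT_basis (0 : ℝ)).eventually_iff.1
    (hsmall.filter_mono nhdsWithin_le_nhds)
  exact ⟨δ₀, hδ₀, fun δ hpos hlt => h ⟨hpos, hlt⟩⟩

end BinNumbers

section Achievability

variable {N M : ℕ} {𝒳 : Fin N → Type*} {Sig : Fin M → Finset (Fin N)} [∀ i, Fintype (𝒳 i)]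
  [∀ i, Nonempty (𝒳 i)] {p : (∀ i, 𝒳 i) → ℝ} {R : ∀ i, noHelperPackets Sig i → ℝ}

theorem achievableByPowerBinning_of_mem_noHelperRegion (hp : p ∈ stdSimplex ℝ (∀ i, 𝒳 i))
    (hR : R ∈ noHelperRegion p Sig) : AchievableByPowerBinning p Sig R := by
  intro η hη ε hε _
  obtain ⟨δ₀, hδ₀, hentropy⟩ :=
    exists_pos_forall_mul_sinkEntropy_le p Sig (half_pos (half_pos hη))
  refine ⟨δ₀, hδ₀, fun δ hδ hδlt => ?_⟩
  have hlim := (tendsto_mass_not_isTypical hp hδ).add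
    ((tendsto_two_rpow_neg_mul (half_pos (half_pos hη))).const_mul (2 ^ N))
  rw [mul_zero, add_zero] at hlim
  have hbins : ∀ᶠ n : ℕ in atTop, ∀ i K, ∃ ℓ : ℕ+, (2 : ℝ) ^ (n * (R i K + η / 2)) ≤ ℓ ∧
      1 / (n : ℝ) * Real.logb 2 ℓ ≤ R i K + η :=
    eventually_all.2 fun i => eventually_all.2 fun K => eventually_exists_two_rpow_le_and_logb_le
      (add_nonneg (hR.1 i K) (half_pos hη).le) (by linarith)
  obtain ⟨n₀, hn₀⟩ := eventually_atTop.1 ((hlim.eventually_lt_const hε).and hbins)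
  refine ⟨n₀, fun n hn => ?_⟩
  obtain ⟨hsmall, hbins⟩ := hn₀ n hn
  choose L hlower hupper using hbins
  refine ⟨L, hupper, (powerBinningError_le hp (by positivity) fun j x hx => ?_).trans_lt hsmall⟩
  exact binningErrorProb_le hp.1 hx (by positivity) fun S hS hne =>
    two_rpow_mul_inv_prod_le hR hS hne (half_pos hη).le hlower (hentropy δ hδ hδlt j S)

theorem exists_errorProb_lt_of_powerBinningError_lt {n : ℕ} {δ ε : ℝ}
    {L : ∀ i, noHelperPackets Sig i → ℕ+} (h : powerBinningError p Sig n δ L < ε) :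
    ∃ b : Binning 𝒳 Sig n L, (powerBinningCode p δ b).errorProb p < ε := by
  classical
  have : Nonempty (Binning 𝒳 Sig n L) := ⟨fun i _ K => ⟨0, (L i K).pos⟩⟩
  rw [powerBinningError, one_div, inv_mul_lt_iff₀ (mod_cast Fintype.card_pos)] at h
  obtain ⟨b, -, hb⟩ := Finset.exists_lt_of_sum_lt (h.trans_eq (by simp :
    _ = ∑ _b : Binning 𝒳 Sig n L, ε))
  exact ⟨b, hb⟩

theorem AchievableByPowerBinning.achievable (h : AchievableByPowerBinning p Sig R) :
    Achievable p Sig (noHelperPackets Sig) R := by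
  intro η hη ε hε hε1
  obtain ⟨δ₀, hδ₀, hδ⟩ := h η hη ε hε hε1
  obtain ⟨n₀, hn₀⟩ := hδ (δ₀ / 2) (half_pos hδ₀) (half_lt_self hδ₀)
  refine ⟨n₀, fun n hn => ?_⟩
  obtain ⟨L, hrate, herror⟩ := hn₀ n hn
  obtain ⟨b, hb⟩ := exists_errorProb_lt_of_powerBinningError_lt herror
  exact ⟨powerBinningCode p (δ₀ / 2) b, hrate, hb⟩

end Achievability

end DIR

theorem theorem2 {N M : ℕ} (𝒳 : Fin N → Type*) [∀ i, Fintype (𝒳 i)] [∀ i, Nonempty (𝒳 i)]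
    (p : (∀ i, 𝒳 i) → ℝ) (hp : p ∈ stdSimplex ℝ (∀ i, 𝒳 i)) (Sig : Fin M → Finset (Fin N)) :
    {R | DIR.Achievable p Sig (DIR.noHelperPackets Sig) R} = DIR.noHelperRegion p Sig ∧
      ∀ R ∈ DIR.noHelperRegion p Sig, DIR.AchievableByPowerBinning p Sig R :=
  ⟨Set.Subset.antisymm (fun _ hR => DIR.Achievable.mem_noHelperRegion hp hR)
      fun _ hR => (DIR.achievableByPowerBinning_of_mem_noHelperRegion hp hR).achievable,
    fun _ hR => DIR.achievableByPowerBinning_of_mem_noHelperRegion hp hR⟩
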